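/- A Steiner triple system STS$(n)$ is a set $V$ of $n$ points together with a collection $\mathcal{B}$ of $3$-element subsets of $V$ (blocks) such that any two distinct points lie together in exactly one block. A cross-free set of size $m$ in a Steiner triple system $(V,\mathcal{B})$ consists of three pairwise disjoint $m$-element sets $X_1,X_2,X_3\subset V$ such that no block $B\in\mathcal{B}$ meets all three of $X_1,X_2,X_3$. Let $G(n)$ be the largest $m$ for which some STS$(n)$ contains a cross-free set of size $m$. Theorem. For every integer $k\ge 0$ and $n=18k+3$, $G(n)=6k$. -/

import Mathlib

/-- A Steiner triple system with point set `V`: a collection of `3`-element blocks such that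
any two distinct points lie together in exactly one block. -/
structure SteinerTripleSystem (V : Type*) where
  /-- The blocks of the system. -/
  blocks : Finset (Finset V)
  card_block : ∀ B ∈ blocks, B.card = 3
  existsUnique_block : ∀ x y : V, x ≠ y → ∃! B, B ∈ blocks ∧ x ∈ B ∧ y ∈ B

/-- `X 0`, `X 1`, `X 2` form a cross-free set of size `m` in the Steiner triple system `S`: they
are pairwise disjoint `m`-element sets of points, and no block of `S` meets all three of them. -/
structure SteinerTripleSystem.IsCrossFree {V : Type*} (S : SteinerTripleSystem V) (m : ℕ)
    (X : Fin 3 → Finset V) : Prop where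
  card_eq : ∀ i, (X i).card = m
  disjoint : ∀ i j, i ≠ j → Disjoint (X i) (X j)
  not_meets_all : ¬ ∃ B ∈ S.blocks, ∀ i, ∃ v, v ∈ B ∧ v ∈ X i

/-- The set of all `m` such that some Steiner triple system on `n` points contains a cross-free
set of size `m`. -/
def crossFreeSizes (n : ℕ) : Set ℕ :=
  {m | ∃ (V : Type) (_ : Fintype V), Fintype.card V = n ∧
    ∃ (S : SteinerTripleSystem V) (X : Fin 3 → Finset V), S.IsCrossFree m X}

/-!
Upper bound. If a cross-free set of size `m > 0` used up all `3m` points, then every pair of points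
from different classes would have its third point in one of these two classes. Sending such an
ordered pair to the pair, inside one class, of the third point and its classmate is injective in
each of the two cases, so `3m · 2m ≤ 2 · 3m (m - 1)`, which is absurd. Hence `3m < 18k + 3`.

Construction. A Steiner triple system is the same thing as a Steiner quasigroup `x, y ↦ f x y`
(`IsSteinerOp`). Start with Skolem's system `Q` on `6k + 1` points and triple it by Bose's
construction on `Q × ZMod 3`. A block of the tripled system meets all three levels only if it is a
column `{x} × ZMod 3`. Fix `c` in `Q`. The blocks `{c, a, b}` through `c` split `Q \ {c}` into
pairs, and each `{c, a, b} × ZMod 3` is a subsystem of order 9, an affine plane with `{c} × ZMod 3`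
as a line. Any other affine plane on these nine points with the same line may be put in its place;
these planes together contain all the unwanted columns. Conjugating by the transposition of
`(a, 0)` with `(b, 2)` makes the lines parallel to `{c} × ZMod 3` become
`{(b, 2), (a, 1), (a, 2)}` and `{(b, 0), (b, 1), (a, 0)}`, neither of which meets all
three levels, while every other line through a point off `{c} × ZMod 3` meets that line.
So the three levels of `(Q \ {c}) × ZMod 3`, of size `6k` each, are cross-free.
-/

/-- A Steiner quasigroup operation: idempotent, commutative, and `z ↦ f x z` is an involution.
Sending two distinct points to the third point of their block turns a Steiner triple system into
such an operation, and conversely. -/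
structure IsSteinerOp {α : Type*} (f : α → α → α) : Prop where
  idem : ∀ x, f x x = x
  comm : ∀ x y, f x y = f y x
  cancel : ∀ x y, f x (f x y) = y

namespace IsSteinerOp

theorem op_ne_left {α : Type*} {f : α → α → α} (hf : IsSteinerOp f) {x y : α} (h : x ≠ y) :
    f x y ≠ x := fun e =>
  h (by have := hf.cancel x y; rw [e, hf.idem] at this; exact this)

theorem op_ne_right {α : Type*} {f : α → α → α} (hf : IsSteinerOp f) {x y : α} (h : x ≠ y) :
    f x y ≠ y := by
  rw [hf.comm]; exact hf.op_ne_left h.symm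

/-- The Steiner triple system whose blocks are the sets `{x, y, f x y}` with `x ≠ y`. -/
def toSteinerTripleSystem {α : Type*} [Fintype α] [DecidableEq α] {f : α → α → α}
    (hf : IsSteinerOp f) : SteinerTripleSystem α where
  blocks := {B ∈ Finset.univ | ∃ x y, x ≠ y ∧ B = {x, y, f x y}}
  card_block := by
    intro B hB
    obtain ⟨x, y, h, rfl⟩ := (Finset.mem_filter.mp hB).2
    exact Finset.card_eq_three.mpr
      ⟨x, y, f x y, h, (hf.op_ne_left h).symm, (hf.op_ne_right h).symm, rfl⟩
  existsUnique_block := by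
    intro x y h
    refine ⟨{x, y, f x y}, ⟨by simpa using ⟨x, y, h, rfl⟩, by simp, by simp⟩, ?_⟩
    rintro B ⟨hB, hx, hy⟩
    obtain ⟨a, b, hab, rfl⟩ := (Finset.mem_filter.mp hB).2
    have c1 := hf.cancel a b
    have c2 : f b (f a b) = a := by rw [hf.comm a b, hf.cancel]
    have c3 := hf.comm a b
    have c4 := hf.comm a (f a b)
    have c5 := hf.comm b (f a b)
    simp only [Finset.mem_insert, Finset.mem_singleton] at hx hy
    ext z
    simp only [Finset.mem_insert, Finset.mem_singleton]
    rcases hx with rfl | rfl | rfl <;> rcases hy with rfl | rfl | rfl <;> grind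

theorem mem_blocks {α : Type*} [Fintype α] [DecidableEq α] {f : α → α → α}
    (hf : IsSteinerOp f) {B : Finset α} :
    B ∈ hf.toSteinerTripleSystem.blocks ↔ ∃ x y, x ≠ y ∧ B = {x, y, f x y} := by
  simp [toSteinerTripleSystem]

end IsSteinerOp

/-! ### Steiner triple systems of order `6k + 1` -/

/-- Third point of the block through `(x, i)` and `(y, i + 1)` in `skolemOp`. -/
def skolemUp {G : Type*} [AddCommGroup G] [DecidableEq G] (H : G → Prop) [DecidablePred H]
    (δ : Equiv.Perm G) (x : G) (i : ZMod 3) (y : G) : Option (G × ZMod 3) :=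
  if δ y = x + x then (if H x then some (x, i + 2) else none) else some (δ y - x, i)

/-- Skolem's operation on `G × ZMod 3` with an added point `none`, where `H` is one half of the
group `G`, `τ` exchanges `H` with its complement, and `δ x = x + x` on `H`. Its blocks are
`{(x, 0), (x, 1), (x, 2)}` and `{none, (τ x, j), (x, j + 1)}` with `x ∈ H`, and
`{(x, j), (y, j), (δ⁻¹ (x + y), j + 1)}` with `x ≠ y`. -/
def skolemOp {G : Type*} [AddCommGroup G] [DecidableEq G] (H : G → Prop) [DecidablePred H]
    (τ : G → G) (δ : Equiv.Perm G) :
    Option (G × ZMod 3) → Option (G × ZMod 3) → Option (G × ZMod 3)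
  | none, none => none
  | none, some (y, j) => if H y then some (τ y, j + 2) else some (τ y, j + 1)
  | some (y, j), none => if H y then some (τ y, j + 2) else some (τ y, j + 1)
  | some (x, i), some (y, j) =>
    if j = i then (if x = y then some (x, i) else some (δ.symm (x + y), i + 1))
    else if j = i + 1 then skolemUp H δ x i y else skolemUp H δ y j x

theorem isSteinerOp_skolemOp {G : Type*} [AddCommGroup G] [DecidableEq G] (H : G → Prop)
    [DecidablePred H] (τ : G → G) (δ : Equiv.Perm G) (hτ : ∀ x, τ (τ x) = x)
    (hH : ∀ x, H (τ x) ↔ ¬ H x) (hτ2 : ∀ x, τ x + τ x = x + x) (hδ : ∀ x, H x → δ x = x + x) :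
    IsSteinerOp (skolemOp H τ δ) := by
  have hδ' : ∀ x, ¬ H x → δ (τ x) = x + x := fun x hx => by
    rw [hδ _ ((hH x).2 hx), hτ2]
  have h3 : ∀ i j : ZMod 3, j = i ∨ j = i + 1 ∨ i = j + 1 := by decide
  have n1 : ∀ i : ZMod 3, i + 1 ≠ i := by decide
  have n1' : ∀ i : ZMod 3, i ≠ i + 1 := by decide
  have n2 : ∀ i : ZMod 3, i ≠ i + 1 + 1 := by decide
  have n3 : ∀ i : ZMod 3, i + 2 ≠ i := by decide
  have h20 : (2 : ZMod 3) ≠ 0 := by decide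
  have h21 : (2 : ZMod 3) ≠ 1 := by decide
  have n4 : ∀ i : ZMod 3, i + 2 ≠ i + 1 := by decide
  have e1 : ∀ i : ZMod 3, i + 1 + 1 = i + 2 := by decide
  have e2 : ∀ i : ZMod 3, i + 1 + 2 = i := by decide
  have e3 : ∀ i : ZMod 3, i + 2 + 1 = i := by decide
  have e4 : ∀ i : ZMod 3, i + 2 + 2 = i + 1 := by decide
  refine ⟨?_, ?_, ?_⟩
  · rintro (_ | ⟨x, i⟩) <;> simp [skolemOp]
  · rintro (_ | ⟨x, i⟩) (_ | ⟨y, j⟩) <;> try rfl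
    rcases h3 i j with rfl | rfl | rfl
    · simp only [skolemOp, if_true]
      by_cases h : x = y
      · simp [h]
      · simp [h, Ne.symm h, add_comm]
    · simp [skolemOp, n1, n1', n2]
    · simp [skolemOp, n1, n1', n2]
  · rintro (_ | ⟨x, i⟩) (_ | ⟨y, j⟩)
    · rfl
    · by_cases h : H y
      · simp [skolemOp, h, hH, hτ, e3]
      · simp [skolemOp, h, hH, hτ, e2]
    · by_cases h : H x
      · have := hδ x h
        simp [skolemOp, skolemUp, h, hH, hτ2, n3, n4, this]
      · have := hδ' x h
        simp [skolemOp, skolemUp, h, this]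
    · rcases h3 i j with rfl | rfl | rfl
      · by_cases h : x = y
        · simp [skolemOp, h]
        · have : x + y ≠ x + x := fun e => h (add_left_cancel e).symm
          simp [skolemOp, skolemUp, h, this, n1]
      · by_cases h : δ y = x + x
        · by_cases hx : H x
          · have : y = x := δ.injective (h.trans (hδ x hx).symm)
            subst this
            simp [skolemOp, skolemUp, h, hx, n1, n3, n4, e4]
          · have : y = τ x := δ.injective (h.trans (hδ' x hx).symm)
            subst this
            simp [skolemOp, skolemUp, h, hx, n1]
        · have : x ≠ δ y - x := fun e => h (by rw [← sub_eq_iff_eq_add.1 e.symm])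
          simp [skolemOp, skolemUp, h, n1, this]
      · by_cases h : δ x = y + y
        · by_cases hx : H y
          · have : x = y := δ.injective (h.trans (hδ y hx).symm)
            subst this
            simp [skolemOp, skolemUp, h, hx, n1', e1, e2, h20, h21]
          · have : x = τ y := δ.injective (h.trans (hδ' y hx).symm)
            subst this
            simp [skolemOp, skolemUp, h, hx, hH, hτ, n1', n2, e2]
        · have : δ x ≠ (δ x - y) + (δ x - y) := fun e => h (by
            rw [← sub_eq_zero] at e ⊢
            rw [← neg_eq_zero, ← e]; abel)
          simp [skolemOp, skolemUp, h, n1', n2, this]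

/-- Skolem's construction on `ZMod (2 * k)`: the half `H` consists of the residues below `k`, which
`δ` doubles to the even residues, while it sends the residues `k + i` to the odd ones `2 * i + 1`. -/
theorem exists_isSteinerOp (k : ℕ) : ∃ (Q : Type) (_ : Fintype Q) (_ : DecidableEq Q)
    (f : Q → Q → Q), Fintype.card Q = 6 * k + 1 ∧ IsSteinerOp f := by
  -- For `k = 0` the group `ZMod 0` is infinite; the one-point system serves instead.
  rcases Nat.eq_zero_or_pos k with rfl | hk
  · exact ⟨Unit, inferInstance, inferInstance, fun _ _ => (), rfl, ⟨by simp, by simp, by simp⟩⟩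
  have : NeZero (2 * k) := ⟨by omega⟩
  let H : ZMod (2 * k) → Prop := fun x => x.val < k
  have : DecidablePred H := fun x => inferInstanceAs (Decidable (x.val < k))
  let d : ZMod (2 * k) → ZMod (2 * k) := fun x => if H x then x + x else x + x + 1
  have hd : Function.Injective d := by
    intro x y hxy
    apply ZMod.val_injective
    have hx := x.val_lt
    have hy := y.val_lt
    have key : ∀ z, ((d z : ZMod (2 * k))).val =
        if z.val < k then 2 * z.val else 2 * z.val + 1 - 2 * k := by
      intro z
      have hz := z.val_lt
      by_cases h : z.val < k
      · have hz2 := ZMod.val_add_of_lt (a := z) (b := z) (by omega)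
        simp only [d, H, if_pos h, hz2]; omega
      · have hz2 := ZMod.val_add_of_le (a := z) (b := z) (by omega)
        have h1 : (1 : ZMod (2 * k)).val = 1 := ZMod.val_one'' (by omega)
        simp only [d, H, if_neg h]
        rw [ZMod.val_add_of_lt (by omega), hz2, h1]; omega
    have := congrArg ZMod.val hxy
    rw [key, key] at this
    split_ifs at this <;> omega
  have hkk : (k : ZMod (2 * k)) + k = 0 := by
    have := ZMod.natCast_self (2 * k)
    push_cast at this
    rw [← this]; ring
  refine ⟨Option (ZMod (2 * k) × ZMod 3), inferInstance, inferInstance,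
    skolemOp H (fun x => x + k) (Equiv.ofBijective d (Finite.injective_iff_bijective.1 hd)),
    ?_, isSteinerOp_skolemOp _ _ _ ?_ ?_ ?_ ?_⟩
  · simp only [Fintype.card_option, Fintype.card_prod, ZMod.card]; ring
  · intro x; rw [add_assoc, hkk, add_zero]
  · intro x
    have hx := x.val_lt
    have hkv : (k : ZMod (2 * k)).val = k := ZMod.val_natCast_of_lt (by omega)
    simp only [H]
    by_cases h : x.val < k
    · rw [ZMod.val_add_of_lt (by omega)]; omega
    · rw [ZMod.val_add_of_le (by omega)]; omega
  · intro x
    calc x + (k : ZMod (2 * k)) + (x + k) = x + x + (k + k) := by ring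
      _ = x + x := by rw [hkk, add_zero]
  · intro x hx
    simp [d, hx]

/-! ### Tripling a Steiner triple system -/

/-- Bose's tripling of a Steiner quasigroup `Q`: an operation on `Q × ZMod 3` whose blocks are the
columns `{(x, 0), (x, 1), (x, 2)}` and the sets `{(x, i), (y, i), (f x y, i + 1)}` with `x ≠ y`. -/
def boseOp {Q : Type*} [DecidableEq Q] (f : Q → Q → Q) (p q : Q × ZMod 3) : Q × ZMod 3 :=
  if p.1 = q.1 then (p.1, -p.2 - q.2) else (f p.1 q.1, 1 - p.2 - q.2)

theorem IsSteinerOp.boseOp {Q : Type*} [DecidableEq Q] {f : Q → Q → Q} (hf : IsSteinerOp f) :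
    IsSteinerOp (boseOp f) := by
  refine ⟨?_, ?_, ?_⟩
  · rintro ⟨x, i⟩
    have : ∀ i : ZMod 3, -i - i = i := by decide
    simp [_root_.boseOp, this]
  · rintro ⟨x, i⟩ ⟨y, j⟩
    have h1 : -i - j = -j - i := by ring
    have h2 : 1 - i - j = 1 - j - i := by ring
    by_cases h : x = y
    · simp [_root_.boseOp, h, h1]
    · simp [_root_.boseOp, h, Ne.symm h, hf.comm x y, h2]
  · rintro ⟨x, i⟩ ⟨y, j⟩
    by_cases h : x = y
    · simp [_root_.boseOp, h]
    · simp [_root_.boseOp, h, (hf.op_ne_left h).symm, hf.cancel]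

/-- Two points are related when they lie in a common triple `{c, x, f c x}`; in particular every
point is related to itself and to `c`. -/
def SameTriple {Q : Type*} (f : Q → Q → Q) (c x y : Q) : Prop :=
  x = y ∨ x = c ∨ y = c ∨ y = f c x

instance {Q : Type*} [DecidableEq Q] (f : Q → Q → Q) (c x y : Q) :
    Decidable (SameTriple f c x y) :=
  inferInstanceAs (Decidable (x = y ∨ x = c ∨ y = c ∨ y = f c x))

namespace SameTriple

variable {Q : Type*} {f : Q → Q → Q} {c x y x' y' : Q}

theorem symm (hf : IsSteinerOp f) (h : SameTriple f c x y) : SameTriple f c y x := by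
  have := hf.cancel c x
  unfold SameTriple at *; grind

theorem op (hf : IsSteinerOp f) (h : SameTriple f c x y) : SameTriple f c x (f x y) := by
  have h1 := hf.cancel x c
  have h2 := hf.comm x c
  have h3 := hf.idem x
  unfold SameTriple at *; grind

theorem move_right (hf : IsSteinerOp f) (h : SameTriple f c x y) (hy : y' = y ∨ y' = f c y) :
    SameTriple f c x y' := by
  have h1 := hf.cancel c x
  have h2 := hf.idem c
  unfold SameTriple at *; grind

theorem move_left (hf : IsSteinerOp f) (h : SameTriple f c x y) (hx : x' = x ∨ x' = f c x) :
    SameTriple f c x' y :=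
  ((h.symm hf).move_right hf hx).symm hf

end SameTriple

/-- For a selection `L` of one point in each pair `{x, f c x}` with `x ≠ c`, the involution
of `Q × ZMod 3` that exchanges `(x, 0)` with `(f c x, 2)` for every `x` in `L`. -/
def twist {Q : Type*} (f : Q → Q → Q) (c : Q) (L : Q → Prop) [DecidablePred L]
    (p : Q × ZMod 3) : Q × ZMod 3 :=
  if L p.1 ∧ p.2 = 0 then (f c p.1, 2)
  else if L (f c p.1) ∧ p.2 = 2 then (f c p.1, 0) else p

theorem twist_fst {Q : Type*} (f : Q → Q → Q) (c : Q) (L : Q → Prop) [DecidablePred L]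
    (p : Q × ZMod 3) : (twist f c L p).1 = p.1 ∨ (twist f c L p).1 = f c p.1 := by
  unfold twist; split_ifs <;> simp

theorem twist_twist {Q : Type*} {f : Q → Q → Q} (hf : IsSteinerOp f) {c : Q} {L : Q → Prop}
    [DecidablePred L] (hL : ∀ x, L x → ¬ L (f c x)) (p : Q × ZMod 3) :
    twist f c L (twist f c L p) = p := by
  obtain ⟨x, i⟩ := p
  by_cases h1 : L x ∧ i = 0
  · obtain ⟨h, rfl⟩ := h1
    simp [twist, h, hL x h, hf.cancel]
  · by_cases h2 : L (f c x) ∧ i = 2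
    · obtain ⟨h, rfl⟩ := h2
      have h20 : (2 : ZMod 3) ≠ 0 := by decide
      simp [twist, h, hf.cancel, h20]
    · simp [twist, h1, h2]

/-- Bose's operation, replaced inside each subsystem `{c, x, f c x} × ZMod 3` by its conjugate
under `twist`. -/
def twistedOp {Q : Type*} [DecidableEq Q] (f : Q → Q → Q) (c : Q) (L : Q → Prop)
    [DecidablePred L] (p q : Q × ZMod 3) : Q × ZMod 3 :=
  if SameTriple f c p.1 q.1 then twist f c L (boseOp f (twist f c L p) (twist f c L q))
  else boseOp f p q

theorem sameTriple_boseOp {Q : Type*} [DecidableEq Q] {f : Q → Q → Q} (hf : IsSteinerOp f)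
    {c : Q} {p q : Q × ZMod 3} (h : SameTriple f c p.1 q.1) :
    SameTriple f c p.1 (boseOp f p q).1 := by
  unfold boseOp; split_ifs
  · exact Or.inl rfl
  · exact h.op hf

/-- Replacing subsystems is harmless because `SameTriple` is symmetric, is preserved by `twist`,
and holds for a pair if and only if it holds for one of its points and the third point. -/
theorem isSteinerOp_twistedOp {Q : Type*} [DecidableEq Q] {f : Q → Q → Q} (hf : IsSteinerOp f)
    {c : Q} {L : Q → Prop} [DecidablePred L] (hL : ∀ x, L x → ¬ L (f c x)) :
    IsSteinerOp (twistedOp f c L) := by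
  have hb := hf.boseOp
  have htt := twist_twist hf hL
  have hmem : ∀ p, p.1 = (twist f c L p).1 ∨ p.1 = f c (twist f c L p).1 := fun p => by
    simpa only [htt] using twist_fst f c L (twist f c L p)
  refine ⟨?_, ?_, ?_⟩
  · intro p
    have : SameTriple f c p.1 p.1 := Or.inl rfl
    simp [twistedOp, this, hb.idem, htt]
  · intro p q
    have : SameTriple f c p.1 q.1 ↔ SameTriple f c q.1 p.1 :=
      ⟨fun h => h.symm hf, fun h => h.symm hf⟩
    by_cases h : SameTriple f c p.1 q.1
    · simp [twistedOp, h, this.1 h, hb.comm (twist f c L p)]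
    · simp [twistedOp, h, mt this.2 h, hb.comm p q]
  · intro p q
    by_cases h : SameTriple f c p.1 q.1
    · have h1 : SameTriple f c (twist f c L p).1 (twist f c L q).1 :=
        (h.move_right hf (twist_fst ..)).move_left hf (twist_fst ..)
      have h2 : SameTriple f c p.1
          (twist f c L (boseOp f (twist f c L p) (twist f c L q))).1 :=
        ((sameTriple_boseOp hf h1).move_left hf (hmem p)).move_right hf (twist_fst ..)
      simp [twistedOp, h, h2, htt, hb.cancel]
    · have h1 : ¬ SameTriple f c p.1 (boseOp f p q).1 := fun h' => h (by
        simpa only [hb.cancel] using sameTriple_boseOp hf h')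
      simp [twistedOp, h, h1, hb.cancel]

/-- Away from the column over `c`, no block of the twisted system meets all three levels. -/
theorem twistedOp_not_transversal {Q : Type*} [DecidableEq Q] {f : Q → Q → Q}
    (hf : IsSteinerOp f) {c : Q} {L : Q → Prop} [DecidablePred L]
    (hL : ∀ x, L x → ¬ L (f c x)) (hL' : ∀ x, x ≠ c → L x ∨ L (f c x)) {p q : Q × ZMod 3}
    (hp : p.1 ≠ c) (hq : q.1 ≠ c) (hpq : p.2 ≠ q.2) :
    (twistedOp f c L p q).1 = c ∨ (twistedOp f c L p q).2 = p.2 ∨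
      (twistedOp f c L p q).2 = q.2 := by
  obtain ⟨x, i⟩ := p
  obtain ⟨y, j⟩ := q
  dsimp only at hp hq hpq
  by_cases h : SameTriple f c x y
  · -- Both points lie over the pair `{a, f c a}`, where `a` is selected by `L`.
    obtain ⟨a, ha, hac, hx, hy⟩ : ∃ a, L a ∧ a ≠ c ∧ (x = a ∨ x = f c a) ∧
        (y = a ∨ y = f c a) := by
      have hxx := hf.cancel c x
      have hcx : f c x ≠ c := hf.op_ne_left hp.symm
      unfold SameTriple at h
      rcases hL' x hp with hx | hx
      · exact ⟨x, hx, hp, by grind, by grind⟩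
      · exact ⟨f c x, hx, hcx, by grind, by grind⟩
    have hb := hL a ha
    have hab : a ≠ f c a := (hf.op_ne_right hac.symm).symm
    have h1 : f a (f c a) = c := by rw [hf.comm c a, hf.cancel]
    have h2 : f (f c a) a = c := by rw [hf.comm, h1]
    have hc : ¬ L c := fun h => hL c h (by rwa [hf.idem])
    have tc : ∀ i, twist f c L (c, i) = (c, i) := fun i => by simp [twist, hc, hf.idem]
    have ta : ∀ i, twist f c L (a, i) = if i = 0 then (f c a, 2) else (a, i) := fun i => by
      simp [twist, ha, hb]
    have tb : ∀ i, twist f c L (f c a, i) = if i = 2 then (a, 0) else (f c a, i) := fun i => by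
      simp [twist, ha, hb, hf.cancel]
    have h3 : ∀ i : ZMod 3, i = 0 ∨ i = 1 ∨ i = 2 := by decide
    simp only [twistedOp, h, if_true]
    rcases hx with rfl | rfl <;> rcases hy with rfl | rfl <;>
      rcases h3 i with rfl | rfl | rfl <;> rcases h3 j with rfl | rfl | rfl <;>
      first
      | exact absurd rfl hpq
      | simp +decide [ta, tb, tc, boseOp, hab, hab.symm, h1, h2]
  · have hxy : x ≠ y := fun e => h (Or.inl e)
    have key : ∀ i j : ZMod 3, i ≠ j → 1 - i - j = i ∨ 1 - i - j = j := by decide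
    right
    simpa [twistedOp, boseOp, h, hxy] using key i j hpq

/-! ### The extremal system -/

theorem IsSteinerOp.eq_op_of_mem_block {α : Type*} [Fintype α] [DecidableEq α] {f : α → α → α}
    (hf : IsSteinerOp f) {B : Finset α} (hB : B ∈ hf.toSteinerTripleSystem.blocks) {x y z : α}
    (hx : x ∈ B) (hy : y ∈ B) (hz : z ∈ B) (hxy : x ≠ y) (hzx : z ≠ x) (hzy : z ≠ y) :
    z = f x y := by
  obtain ⟨a, b, hab, rfl⟩ := hf.mem_blocks.1 hB
  have c1 := hf.cancel a b
  have c2 : f b (f a b) = a := by rw [hf.comm a b, hf.cancel]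
  have c3 := hf.comm a b
  have c4 := hf.comm a (f a b)
  have c5 := hf.comm b (f a b)
  simp only [Finset.mem_insert, Finset.mem_singleton] at hx hy hz
  grind

theorem six_mul_mem_crossFreeSizes (k : ℕ) : 6 * k ∈ crossFreeSizes (18 * k + 3) := by
  obtain ⟨Q, _, _, f, hQ, hf⟩ := exists_isSteinerOp k
  have hpos : 0 < Fintype.card Q := by omega
  obtain ⟨c⟩ := Fintype.card_pos_iff.1 hpos
  let e := Fintype.equivFin Q
  -- An arbitrary numbering of the points selects one point in each pair `{x, f c x}`.
  let L : Q → Prop := fun x => e x < e (f c x)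
  have : DecidablePred L := fun x => inferInstanceAs (Decidable (e x < e (f c x)))
  have hL : ∀ x, L x → ¬ L (f c x) := fun x h => by
    simpa [L, hf.cancel] using h.le
  have hL' : ∀ x, x ≠ c → L x ∨ L (f c x) := fun x h => by
    have : e x ≠ e (f c x) := fun h' => hf.op_ne_right h.symm (e.injective h').symm
    simpa [L, hf.cancel] using lt_or_gt_of_ne this
  have ht := isSteinerOp_twistedOp hf hL
  obtain ⟨l, hl⟩ : ∃ l : Fin 3 → ZMod 3, Function.Injective l :=
    ⟨fun i => (i.val : ZMod 3), by decide⟩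
  refine ⟨Q × ZMod 3, inferInstance, ?_, ht.toSteinerTripleSystem,
    fun i => (Finset.univ.erase c) ×ˢ {l i}, ?_, ?_, ?_⟩
  · rw [Fintype.card_prod, hQ, ZMod.card]; ring
  · intro i
    simp [hQ]
  · intro i j hij
    rw [Finset.disjoint_left]
    rintro p h1 h2
    simp only [Finset.mem_product, Finset.mem_singleton] at h1 h2
    exact hij (hl (h1.2.symm.trans h2.2))
  · rintro ⟨B, hB, h⟩
    choose v hvB hv using h
    simp only [Finset.mem_product, Finset.mem_singleton, Finset.mem_erase] at hv
    have hne : ∀ i j : Fin 3, i ≠ j → v i ≠ v j := fun i j hij h => hij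
      (hl ((hv i).2.symm.trans ((congrArg Prod.snd h).trans (hv j).2)))
    have h2 := ht.eq_op_of_mem_block hB (hvB 0) (hvB 1) (hvB 2) (hne 0 1 (by decide))
      (hne 2 0 (by decide)) (hne 2 1 (by decide))
    have h3 := twistedOp_not_transversal hf hL hL' (hv 0).1.1 (hv 1).1.1
      (by rw [(hv 0).2, (hv 1).2]; exact hl.ne (by decide))
    rw [← h2, (hv 0).2, (hv 1).2, (hv 2).2] at h3
    rcases h3 with h3 | h3 | h3
    · exact (hv 2).1.1 h3
    · exact absurd (hl h3) (by decide)
    · exact absurd (hl h3) (by decide)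

/-! ### The upper bound -/

/-- The three sets of a cross-free set of positive size do not exhaust the points. -/
theorem SteinerTripleSystem.IsCrossFree.three_mul_lt_card {V : Type*} [Fintype V]
    {S : SteinerTripleSystem V} {m : ℕ} {X : Fin 3 → Finset V} (h : S.IsCrossFree m X)
    (hm : 0 < m) : 3 * m < Fintype.card V := by
  classical
  have hcard : (Finset.univ.biUnion X).card = 3 * m := by
    rw [Finset.card_biUnion fun i _ j _ hij => h.disjoint i j hij]
    simp [h.card_eq]
  by_contra hlt
  have huniv : Finset.univ.biUnion X = Finset.univ :=
    Finset.eq_univ_of_card _ (le_antisymm (Finset.card_le_univ _) (by omega))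
  have hV : Fintype.card V = 3 * m := by rw [← hcard, huniv, Finset.card_univ]
  have hex : ∀ v, ∃ i, v ∈ X i := fun v => by
    have := Finset.mem_univ v
    rw [← huniv] at this
    simpa using this
  choose cl hcl using hex
  have hclX : ∀ v i, v ∈ X i → cl v = i := fun v i hv => by
    by_contra hne
    exact Finset.disjoint_left.1 (h.disjoint _ _ hne) (hcl v) hv
  have hthird : ∀ x y, ∃ z, x ≠ y → z ≠ x ∧ z ≠ y ∧ {x, y, z} ∈ S.blocks := by
    intro x y
    by_cases hxy : x = y
    · exact ⟨x, fun h' => absurd hxy h'⟩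
    obtain ⟨B, ⟨hB, hx, hy⟩, -⟩ := S.existsUnique_block x y hxy
    obtain ⟨a, b, c, hab, hac, hbc, rfl⟩ := Finset.card_eq_three.1 (S.card_block B hB)
    have : ∃ z, z ≠ x ∧ z ≠ y ∧ ({a, b, c} : Finset V) = {x, y, z} := by
      simp only [Finset.mem_insert, Finset.mem_singleton] at hx hy
      rcases hx with hx | hx | hx <;> rcases hy with hy | hy | hy <;>
        first
        | exact absurd (hx.trans hy.symm) hxy
        | exact ⟨c, by grind, by grind, by ext; simp; grind⟩
        | exact ⟨b, by grind, by grind, by ext; simp; grind⟩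
        | exact ⟨a, by grind, by grind, by ext; simp; grind⟩
    obtain ⟨z, h1, h2, h3⟩ := this
    exact ⟨z, fun _ => ⟨h1, h2, h3 ▸ hB⟩⟩
  choose t ht using hthird
  have hinj : ∀ x y y', x ≠ y → x ≠ y' → t x y = t x y' → y = y' := by
    intro x y y' h1 h2 h3
    obtain ⟨a1, a2, a3⟩ := ht x y h1
    obtain ⟨b1, b2, b3⟩ := ht x y' h2
    have := (S.existsUnique_block x (t x y) a1.symm).unique ⟨a3, by simp, by simp⟩
      ⟨b3, by simp, by simp [h3]⟩
    have hy : y ∈ ({x, y', t x y'} : Finset V) := this ▸ by simp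
    simp only [Finset.mem_insert, Finset.mem_singleton] at hy
    grind
  have hsymm : ∀ x y, x ≠ y → t x y = t y x := by
    intro x y h1
    obtain ⟨a1, a2, a3⟩ := ht x y h1
    obtain ⟨b1, b2, b3⟩ := ht y x h1.symm
    have := (S.existsUnique_block x y h1).unique ⟨a3, by simp, by simp⟩
      ⟨b3, by simp, by simp⟩
    have hy : t x y ∈ ({y, x, t y x} : Finset V) := this ▸ by simp
    simp only [Finset.mem_insert, Finset.mem_singleton] at hy
    grind
  -- `A` holds the ordered pairs of points in different classes, `I` those in the same class.
  let A : Finset (Σ _ : V, V) := Finset.univ.sigma fun x => (X (cl x))ᶜ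
  let I : Finset (Σ _ : V, V) := Finset.univ.sigma fun x => (X (cl x)).erase x
  have hA : A.card = 3 * m * (2 * m) := by
    have : 3 * m - m = 2 * m := by omega
    simp [A, Finset.card_sigma, Finset.card_compl, h.card_eq, hV, this]
  have hI : I.card = 3 * m * (m - 1) := by
    simp [I, Finset.card_sigma, Finset.card_erase_of_mem, hcl, h.card_eq, hV]
  have memA : ∀ p, p ∈ A ↔ cl p.2 ≠ cl p.1 := fun p => by
    simp only [A, Finset.mem_sigma, Finset.mem_univ, true_and, Finset.mem_compl]
    exact not_congr ⟨fun h' => hclX _ _ h', fun h' => h' ▸ hcl _⟩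
  have memI : ∀ p, p ∈ I ↔ p.2 ≠ p.1 ∧ cl p.2 = cl p.1 := fun p => by
    simp only [I, Finset.mem_sigma, Finset.mem_univ, true_and, Finset.mem_erase]
    exact and_congr_right fun _ => ⟨fun h' => hclX _ _ h', fun h' => h' ▸ hcl _⟩
  have hne : ∀ p ∈ A, p.1 ≠ p.2 := fun p hp e => (memA p).1 hp (by rw [e])
  -- The third point of the block through a pair in `A` lies in one of the two classes involved.
  have hcase : ∀ p ∈ A, ¬ cl (t p.1 p.2) = cl p.1 → cl (t p.1 p.2) = cl p.2 := by
    intro p hp h1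
    by_contra h2
    have h0 := (memA p).1 hp
    obtain ⟨a1, a2, a3⟩ := ht _ _ (hne p hp)
    refine h.not_meets_all ⟨_, a3, fun i => ?_⟩
    have : ∀ a b d i : Fin 3, b ≠ a → d ≠ a → d ≠ b → i = a ∨ i = b ∨ i = d := by decide
    rcases this _ _ _ i h0 h1 h2 with rfl | rfl | rfl
    · exact ⟨_, by simp, hcl _⟩
    · exact ⟨_, by simp, hcl _⟩
    · exact ⟨_, by simp, hcl _⟩
  have hle1 : (A.filter fun p => cl (t p.1 p.2) = cl p.1).card ≤ I.card := by
    refine Finset.card_le_card_of_injOn (fun p => ⟨p.1, t p.1 p.2⟩) ?_ ?_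
    · intro p hp
      obtain ⟨hp, hc⟩ := Finset.mem_filter.1 hp
      exact (memI _).2 ⟨(ht _ _ (hne p hp)).1, hc⟩
    · rintro ⟨x, y⟩ hp ⟨x', y'⟩ hp' e
      have h1 := hne _ (Finset.mem_filter.1 hp).1
      have h2 := hne _ (Finset.mem_filter.1 hp').1
      simp only [Sigma.mk.injEq, heq_eq_eq] at e
      obtain ⟨rfl, e⟩ := e
      obtain rfl : y = y' := hinj _ _ _ h1 h2 e
      rfl
  have hle2 : (A.filter fun p => ¬ cl (t p.1 p.2) = cl p.1).card ≤ I.card := by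
    refine Finset.card_le_card_of_injOn (fun p => ⟨p.2, t p.1 p.2⟩) ?_ ?_
    · intro p hp
      obtain ⟨hp, hc⟩ := Finset.mem_filter.1 hp
      exact (memI _).2 ⟨(ht _ _ (hne p hp)).2.1, hcase p hp hc⟩
    · rintro ⟨x, y⟩ hp ⟨x', y'⟩ hp' e
      have h1 := hne _ (Finset.mem_filter.1 hp).1
      have h2 := hne _ (Finset.mem_filter.1 hp').1
      simp only [Sigma.mk.injEq, heq_eq_eq] at e
      obtain ⟨rfl, e⟩ := e
      rw [hsymm _ _ h1, hsymm _ _ h2] at e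
      obtain rfl : x = x' := hinj _ _ _ h1.symm h2.symm e
      rfl
  have hsum := Finset.card_filter_add_card_filter_not (s := A)
    (fun p => cl (t p.1 p.2) = cl p.1)
  have hlt : 3 * m * (m - 1) < 3 * m * m := Nat.mul_lt_mul_of_pos_left (by omega) (by omega)
  have : 3 * m * (2 * m) = 3 * m * m + 3 * m * m := by ring
  omega

theorem theorem2 (k : ℕ) : IsGreatest (crossFreeSizes (18 * k + 3)) (6 * k) := by
  refine ⟨six_mul_mem_crossFreeSizes k, ?_⟩
  rintro m ⟨V, _, hV, S, X, h⟩
  rcases Nat.eq_zero_or_pos m with rfl | hm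
  · exact Nat.zero_le _
  · have := h.three_mul_lt_card hm
    omega
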